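/- Parrondo's coin-tossing games are as follows. In game $A$ a fair coin is tossed. In game $B$, with integer parameter $r\ge 3$ and real parameter $\rho\in[0,1)$, a coin with probability of heads $p_0=\rho^{r-1}/(1+\rho^{r-1})$ is tossed if the current capital (an integer) is a multiple of $r$, and a coin with probability of heads $p_1=1/(1+\rho)$ is tossed otherwise. In either game the player wins one unit with heads and loses one unit with tails. For a finite nonempty word $\Gamma$ in the letters $A,B$, let $\mu(r,\rho,\Gamma)$ denote the rate of profit when the pattern $\Gamma$ is played repeatedly ad infinitum, i.e. the (constant) almost sure limit of $(X_n-X_0)/n$ as $n\to\infty$, where $X_n$ is the capital after $n$ games and $X_0$ is the (deterministic) initial capital. For each integer $r\ge3$ let $s_r:=\lfloor\log_2 r\rfloor-1$, and let an integer initial capital $x_r$ be given, which is even if $r$ is even. Then for every $r\ge 3$ the rate of profit $\mu(r,0,(AB)^{s_r}B^{r-2})$ with initial capital $x_r$ exists, and $$1-\mu\bigl(r,0,(AB)^{s_r}B^{r-2}\bigr)\sim\frac{2s_r}{r}\qquad\text{as } r\to\infty.$$ -/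

import Mathlib

open Filter Topology MeasureTheory Asymptotics

namespace Parrondo

/-- The two coin-tossing games. -/
inductive Game where
  | A
  | B

/-- The probability of heads of the coin that is tossed in the given game when the current capital
is `x`. Game `A` uses a fair coin. Game `B` uses the coin with
`p₀ = ρ ^ (r - 1) / (1 + ρ ^ (r - 1))` if the capital is a multiple of `r`, and the coin with
`p₁ = 1 / (1 + ρ)` otherwise. -/
noncomputable def headsProb (r : ℕ) (ρ : ℝ) (g : Game) (x : ℤ) : ℝ :=
  match g with
  | Game.A => 1 / 2
  | Game.B => if (r : ℤ) ∣ x then ρ ^ (r - 1) / (1 + ρ ^ (r - 1)) else 1 / (1 + ρ)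

/-- The game played at turn `n + 1` when the (nonempty) pattern `Γ` is repeated ad infinitum. The
default value of `getD` is only reached for the empty pattern. -/
def gameAt (Γ : List Game) (n : ℕ) : Game :=
  Γ.getD (n % Γ.length) Game.A

/-- The law of a sequence of independent random variables, each uniform on `[0, 1]`. -/
noncomputable def uniformSeq : Measure (ℕ → unitInterval) :=
  Measure.infinitePi fun _ : ℕ => (volume : Measure unitInterval)

/-- The player's capital after `n` turns, with initial capital `x₀`, when the pattern `Γ` is
repeated ad infinitum. The `p`-coin of turn `n + 1` shows heads if `ω n < p`, which has probability
`p` for `p ∈ [0, 1]`; the player wins one unit with heads and loses one unit with tails. -/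
noncomputable def capital (r : ℕ) (ρ : ℝ) (Γ : List Game) (x₀ : ℤ) (ω : ℕ → unitInterval) : ℕ → ℤ
  | 0 => x₀
  | n + 1 =>
    if (ω n : ℝ) < headsProb r ρ (gameAt Γ n) (capital r ρ Γ x₀ ω n) then
      capital r ρ Γ x₀ ω n + 1
    else
      capital r ρ Γ x₀ ω n - 1

/-- `HasRateOfProfit r ρ Γ x₀ m` says that the rate of profit `μ(r, ρ, Γ)` with initial capital
`x₀` exists and equals `m`: the cumulative profit per game played converges to the constant `m`
almost surely. -/
def HasRateOfProfit (r : ℕ) (ρ : ℝ) (Γ : List Game) (x₀ : ℤ) (m : ℝ) : Prop :=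
  ∀ᵐ ω ∂uniformSeq,
    Tendsto (fun n : ℕ => ((capital r ρ Γ x₀ ω n : ℝ) - (x₀ : ℝ)) / (n : ℝ)) atTop (𝓝 m)

/-- The rate of profit is unique when it exists. -/
theorem HasRateOfProfit.unique {r : ℕ} {ρ : ℝ} {Γ : List Game} {x₀ : ℤ} {m m' : ℝ}
    (h : HasRateOfProfit r ρ Γ x₀ m) (h' : HasRateOfProfit r ρ Γ x₀ m') : m = m' := by
  have : IsProbabilityMeasure uniformSeq := by
    unfold uniformSeq
    infer_instance
  obtain ⟨ω, h1, h2⟩ := (Filter.Eventually.and h h').exists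
  exact tendsto_nhds_unique h1 h2

/-- The pattern `(AB)^s B^(r-2)`. -/
def pattern (r s : ℕ) : List Game :=
  (List.replicate s [Game.A, Game.B]).flatten ++ List.replicate (r - 2) Game.B

/-- `s_r = ⌊log₂ r⌋ - 1`, a nonnegative integer for `r ≥ 2`. -/
noncomputable def sFun (r : ℕ) : ℕ := ⌊Real.logb 2 (r : ℝ)⌋₊ - 1

end Parrondo

/-!
With `ρ = 0`, game `B` is lost at the multiples of `r` and won everywhere else, so only the fair
coins of game `A` are random. A period of `(AB)^s B^(r-2)` that begins at a multiple `M` of `r`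
ends at `M + r`, unless all its `s` fair coins show tails: then the capital oscillates between
`M` and `M - 1` and the period ends at `M - (r % 2)`. When `r` is odd, the period after such a
failure begins at `M - 1`, where the fair coins have no influence on its outcome, and it leads
back to `M`. Failures have probability `q = 2⁻ˢ` and are independent of the past, so by a strong
law of large numbers the mean profit of a period is `r (1 - q) / (1 + (r % 2) q)`, while its
length is `2 s + r - 2`. As `q` is of order `1 / r` for `s = s_r`, the defect of the rate from
`1` is dominated by the `2 s` extra games of the period.
-/

namespace Parrondo

section Deterministic

theorem tendsto_div_of_tendsto_subseq_div {u : ℕ → ℝ} {K l : ℝ}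
    (hu : ∀ n, u n - K ≤ u (n + 1)) {c : ℕ → ℕ} (hc : Tendsto c atTop atTop)
    (hratio : Tendsto (fun k => (c (k + 1) : ℝ) / c k) atTop (𝓝 1))
    (hl : Tendsto (fun k => u (c k) / c k) atTop (𝓝 l)) :
    Tendsto (fun n => u n / n) atTop (𝓝 l) := by
  have add_div_eq {n : ℕ} (hn : 0 < n) : (u n + K * n) / n = u n / n + K := by
    field_simp
  have hmono : Monotone fun n : ℕ => u n + K * n := monotone_nat_of_le_succ fun n => by
    push_cast
    linarith [hu n]
  have hdrift : Tendsto (fun n : ℕ => (u n + K * n) / n) atTop (𝓝 (l + K)) := by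
    refine tendsto_div_of_monotone_of_exists_subseq_tendsto_div _ _ hmono fun a ha =>
      ⟨c, ?_, hc, ?_⟩
    · filter_upwards [hratio.eventually_le_const ha, hc.eventually_gt_atTop 0] with k hk hck
      exact (div_le_iff₀ (Nat.cast_pos.2 hck)).1 hk
    · refine (hl.add_const K).congr' ?_
      filter_upwards [hc.eventually_gt_atTop 0] with k hck
      exact (add_div_eq hck).symm
  rw [← add_sub_cancel_right l K]
  refine (hdrift.sub_const K).congr' ?_
  filter_upwards [eventually_gt_atTop 0] with n hn
  rw [add_div_eq hn, add_sub_cancel_right]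

theorem tendsto_sum_div_of_tendsto_subseq_sum_div {a : ℕ → ℝ} {K l : ℝ} (ha : ∀ n, |a n| ≤ K)
    {c : ℕ → ℕ} (hc : Tendsto c atTop atTop)
    (hratio : Tendsto (fun k => (c (k + 1) : ℝ) / c k) atTop (𝓝 1))
    (hl : Tendsto (fun k => (∑ i ∈ Finset.range (c k), a i) / c k) atTop (𝓝 l)) :
    Tendsto (fun n : ℕ => (∑ i ∈ Finset.range n, a i) / n) atTop (𝓝 l) :=
  tendsto_div_of_tendsto_subseq_div (K := K)
    (fun n => by rw [Finset.sum_range_succ]; linarith [neg_le_of_abs_le (ha n)]) hc hratio hl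

theorem tendsto_succ_div_self_atTop :
    Tendsto (fun n : ℕ => ((n + 1 : ℕ) : ℝ) / n) atTop (𝓝 1) := by
  have h := (tendsto_inv_atTop_nhds_zero_nat (𝕜 := ℝ)).const_add 1
  rw [add_zero] at h
  refine h.congr' ?_
  filter_upwards [eventually_gt_atTop 0] with n hn
  push_cast
  field_simp

theorem tendsto_div_of_tendsto_succ_div {p : ℕ → ℝ} {l : ℝ}
    (h : Tendsto (fun n : ℕ => p (n + 1) / n) atTop (𝓝 l)) :
    Tendsto (fun n => p n / n) atTop (𝓝 l) := by
  rw [← tendsto_add_atTop_iff_nat 1, ← div_one l]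
  refine (h.div tendsto_succ_div_self_atTop one_ne_zero).congr' ?_
  filter_upwards [eventually_ne_atTop 0] with n hn
  exact div_div_div_cancel_right₀ (Nat.cast_ne_zero.2 hn) _ _

/-- Here `v k` says whether the `k`-th stage is active and `τ k` whether its trial fails: an
active failure makes the next stage inactive with weight `δ`, and `p` gains `c` at each active
success. Up to the bounded terms `v 0 - v n`, the number `V` of active stages before `n` satisfies
`V = n - δ q V` and `p n = c (1 - q) V`. -/
theorem tendsto_div_of_renewal {p v τ : ℕ → ℝ} {c δ q K : ℝ} (hδq : 1 + δ * q ≠ 0)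
    (hvK : ∀ k, |v k| ≤ K) (hv : ∀ k, v (k + 1) = 1 - δ * (v k * τ k))
    (hp : ∀ k, p (k + 1) - p k = c * (v k * (1 - τ k)) + (v (k + 1) - v k))
    (hτ : Tendsto (fun n : ℕ => (∑ k ∈ Finset.range n, v k * (τ k - q)) / n) atTop (𝓝 0)) :
    Tendsto (fun n => p n / n) atTop (𝓝 (c * (1 - q) / (1 + δ * q))) := by
  set V : ℕ → ℝ := fun n => ∑ k ∈ Finset.range n, v k
  set E : ℕ → ℝ := fun n => ∑ k ∈ Finset.range n, v k * (τ k - q)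
  set l : ℝ := c * (1 - q) / (1 + δ * q)
  have hl : l * (1 + δ * q) = c * (1 - q) := div_mul_cancel₀ _ hδq
  have failures (n : ℕ) : ∑ k ∈ Finset.range n, v k * τ k = E n + q * V n := by
    rw [Finset.mul_sum, ← Finset.sum_add_distrib]
    exact Finset.sum_congr rfl fun k _ => by ring
  have active (n : ℕ) : V n + v n = n - δ * (E n + q * V n) + v 0 := by
    rw [← Finset.sum_range_succ, Finset.sum_range_succ', ← failures]
    simp only [hv, Finset.sum_sub_distrib, Finset.mul_sum, Finset.sum_const, Finset.card_range,
      nsmul_eq_mul, mul_one]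
  have gain (n : ℕ) : p n - p 0 = c * (V n - (E n + q * V n)) + (v n - v 0) := by
    rw [← Finset.sum_range_sub p, Finset.sum_congr rfl fun k _ => hp k, Finset.sum_add_distrib,
      Finset.sum_range_sub v, ← Finset.mul_sum, ← failures, ← Finset.sum_sub_distrib]
    simp only [mul_sub, mul_one]
  have closed_form (n : ℕ) :
      p n = l * n - (c + l * δ) * E n + (p 0 + (1 - l) * (v n - v 0)) := by
    linear_combination gain n + l * active n - V n * hl
  have hE : Tendsto (fun n => E n / n) atTop (𝓝 0) := hτ
  have hinv := tendsto_inv_atTop_nhds_zero_nat (𝕜 := ℝ)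
  have hv0 : Tendsto (fun n => v n / n) atTop (𝓝 0) :=
    tendsto_bdd_div_atTop_nhds_zero (Eventually.of_forall fun n => neg_le_of_abs_le (hvK n))
      (Eventually.of_forall fun n => le_of_abs_le (hvK n)) tendsto_natCast_atTop_atTop
  have hlim := ((hE.const_mul (c + l * δ)).const_sub l).add
    ((hinv.const_mul (p 0)).add ((hv0.sub (hinv.const_mul (v 0))).const_mul (1 - l)))
  simp only [mul_zero, sub_zero, add_zero] at hlim
  refine hlim.congr' ?_
  filter_upwards [eventually_gt_atTop 0] with n hn
  rw [closed_form n]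
  field_simp

end Deterministic

section StrongLaw

variable {Ω : Type*} [MeasurableSpace Ω] {P : Measure Ω}

theorem ae_tendsto_zero_of_summable_integral {Y : ℕ → Ω → ℝ} (hint : ∀ n, Integrable (Y n) P)
    (hnonneg : ∀ n, 0 ≤ᵐ[P] Y n) (hsum : Summable fun n => ∫ ω, Y n ω ∂P) :
    ∀ᵐ ω ∂P, Tendsto (fun n => Y n ω) atTop (𝓝 0) := by
  have hmeas (n : ℕ) : AEMeasurable (fun ω => ENNReal.ofReal (Y n ω)) P :=
    (hint n).aemeasurable.ennreal_ofReal
  have hfin : ∫⁻ ω, ∑' n, ENNReal.ofReal (Y n ω) ∂P ≠ ⊤ := by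
    rw [lintegral_tsum hmeas]
    simp_rw [← fun n => ofReal_integral_eq_lintegral_ofReal (hint n) (hnonneg n)]
    exact hsum.tsum_ofReal_ne_top
  filter_upwards [ae_lt_top' (AEMeasurable.tsum hmeas) hfin, ae_all_iff.2 hnonneg] with ω hω h0
  refine ((ENNReal.tendsto_toReal ENNReal.zero_ne_top).comp
    (ENNReal.tendsto_atTop_zero_of_tsum_ne_top hω.ne)).congr fun n => ?_
  exact ENNReal.toReal_ofReal (h0 n)

theorem integral_sq_sum_of_orthogonal {ι : Type*} {X : ι → Ω → ℝ} (hX : ∀ i, MemLp (X i) 2 P)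
    (horth : Pairwise fun i j => ∫ ω, X i ω * X j ω ∂P = 0) (s : Finset ι) :
    ∫ ω, (∑ i ∈ s, X i ω) ^ 2 ∂P = ∑ i ∈ s, ∫ ω, X i ω ^ 2 ∂P := by
  have hint (i j : ι) : Integrable (fun ω => X i ω * X j ω) P := (hX i).integrable_mul (hX j)
  simp_rw [sq, Finset.sum_mul_sum]
  rw [integral_finsetSum _ fun i _ => integrable_finsetSum _ fun j _ => hint i j]
  refine Finset.sum_congr rfl fun i hi => ?_
  rw [integral_finsetSum _ fun j _ => hint i j]
  exact Finset.sum_eq_single_of_mem i hi fun j _ hji => horth hji.symm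

theorem ae_tendsto_sum_div_of_orthogonal [IsFiniteMeasure P] {X : ℕ → Ω → ℝ} {C : ℝ}
    (hX : ∀ n, AEStronglyMeasurable (X n) P) (hC : ∀ n, ∀ᵐ ω ∂P, |X n ω| ≤ C)
    (horth : Pairwise fun i j => ∫ ω, X i ω * X j ω ∂P = 0) :
    ∀ᵐ ω ∂P, Tendsto (fun n : ℕ => (∑ i ∈ Finset.range n, X i ω) / n) atTop (𝓝 0) := by
  -- The second moments of the averages are summable along the squares, and the bound `C` controls
  -- the averages in between.
  have hLp (n : ℕ) : MemLp (X n) 2 P := MemLp.of_bound (hX n) C (hC n)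
  let Y (m : ℕ) (ω : Ω) : ℝ := ((∑ i ∈ Finset.range (m ^ 2), X i ω) / (m ^ 2 : ℕ)) ^ 2
  have integrable_Y (m : ℕ) : Integrable (Y m) P :=
    ((memLp_finsetSum _ fun i _ => hLp i).mul_const _).integrable_sq
  have integral_Y_le (m : ℕ) : ∫ ω, Y m ω ∂P ≤ C ^ 2 * P.real Set.univ * (1 / (m : ℝ) ^ 2) := by
    have integral_sq_le (n : ℕ) : ∫ ω, X n ω ^ 2 ∂P ≤ C ^ 2 * P.real Set.univ := by
      refine (Real.le_norm_self _).trans (norm_integral_le_of_norm_le_const ?_)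
      filter_upwards [hC n] with ω hω
      simpa only [norm_pow, Real.norm_eq_abs] using pow_le_pow_left₀ (abs_nonneg _) hω 2
    calc ∫ ω, Y m ω ∂P
        = (∑ i ∈ Finset.range (m ^ 2), ∫ ω, X i ω ^ 2 ∂P) / ((m ^ 2 : ℕ) : ℝ) ^ 2 := by
          simp only [Y, div_pow, integral_div]
          rw [integral_sq_sum_of_orthogonal hLp horth]
      _ ≤ (∑ i ∈ Finset.range (m ^ 2), C ^ 2 * P.real Set.univ) / ((m ^ 2 : ℕ) : ℝ) ^ 2 := by
          gcongr with i
          exact integral_sq_le i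
      _ = C ^ 2 * P.real Set.univ * (1 / (m : ℝ) ^ 2) := by
          rcases eq_or_ne m 0 with rfl | hm
          · simp
          · simp only [Finset.sum_const, Finset.card_range, nsmul_eq_mul]
            push_cast
            field_simp
  have hsum : Summable fun m => ∫ ω, Y m ω ∂P :=
    .of_nonneg_of_le (fun m => integral_nonneg fun ω => sq_nonneg _) integral_Y_le
      ((Real.summable_one_div_nat_pow.2 one_lt_two).mul_left _)
  filter_upwards [ae_all_iff.2 hC, ae_tendsto_zero_of_summable_integral integrable_Y
    (fun m => ae_of_all _ fun ω => sq_nonneg _) hsum] with ω hCω hω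
  refine tendsto_sum_div_of_tendsto_subseq_sum_div hCω (tendsto_pow_atTop two_ne_zero) ?_ ?_
  · simpa [div_pow] using tendsto_succ_div_self_atTop.pow 2
  · rw [tendsto_zero_iff_abs_tendsto_zero]
    simpa [Y, Function.comp_def, Real.sqrt_sq_eq_abs] using (Real.continuous_sqrt.tendsto 0).comp hω

open ProbabilityTheory in
theorem ae_tendsto_sum_mul_div_of_indep [IsFiniteMeasure P] {ℱ : Filtration ℕ ‹_›}
    {Z ξ : ℕ → Ω → ℝ} {C D : ℝ} (hZ : ∀ n, Measurable[ℱ n] (Z n))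
    (hξ : ∀ n, Measurable[ℱ (n + 1)] (ξ n))
    (hindep : ∀ n, Indep (ℱ n) (MeasurableSpace.comap (ξ n) inferInstance) P)
    (hZC : ∀ n ω, |Z n ω| ≤ C) (hξD : ∀ n ω, |ξ n ω| ≤ D) (hmean : ∀ n, ∫ ω, ξ n ω ∂P = 0) :
    ∀ᵐ ω ∂P, Tendsto (fun n : ℕ => (∑ k ∈ Finset.range n, Z k ω * ξ k ω) / n) atTop (𝓝 0) := by
  have hZ' (n : ℕ) : Measurable (Z n) := (hZ n).mono (ℱ.le n) le_rfl
  have hξ' (n : ℕ) : Measurable (ξ n) := (hξ n).mono (ℱ.le _) le_rfl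
  have orth_of_lt {i j : ℕ} (hij : i < j) :
      ∫ ω, (Z i ω * ξ i ω) * (Z j ω * ξ j ω) ∂P = 0 := by
    have hpast : Measurable[ℱ j] fun ω => Z i ω * ξ i ω * Z j ω :=
      (((hZ i).mono (ℱ.mono hij.le) le_rfl).mul ((hξ i).mono (ℱ.mono hij) le_rfl)).mul (hZ j)
    have hind : IndepFun (fun ω => Z i ω * ξ i ω * Z j ω) (ξ j) P :=
      (IndepFun_iff_Indep _ _ _).2 (indep_of_indep_of_le_left (hindep j) hpast.comap_le)
    simp_rw [← mul_assoc]
    rw [hind.integral_fun_mul_eq_mul_integral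
      (hpast.mono (ℱ.le j) le_rfl).aestronglyMeasurable (hξ' j).aestronglyMeasurable,
      hmean, mul_zero]
  refine ae_tendsto_sum_div_of_orthogonal (C := C * D)
    (fun n => ((hZ' n).mul (hξ' n)).aestronglyMeasurable) (fun n => ae_of_all _ fun ω => ?_) ?_
  · rw [abs_mul]
    exact mul_le_mul (hZC n ω) (hξD n ω) (abs_nonneg _) ((abs_nonneg _).trans (hZC n ω))
  · intro i j hij
    rcases hij.lt_or_gt with h | h
    · exact orth_of_lt h
    · simpa only [mul_comm] using orth_of_lt h

end StrongLaw

section Product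

open ProbabilityTheory

theorem indep_cylinderEvents_infinitePi {ι : Type*} {X : ι → Type*} [∀ i, MeasurableSpace (X i)]
    (μ : ∀ i, Measure (X i)) [∀ i, IsProbabilityMeasure (μ i)] {S T : Set ι} (hST : Disjoint S T) :
    Indep (cylinderEvents S) (cylinderEvents T) (Measure.infinitePi μ) :=
  indep_iSup_of_disjoint (fun i => (measurable_pi_apply i).comap_le)
    (iIndepFun_infinitePi fun _ => measurable_id) hST

end Product

section StepB

/-- The capital after one round of game `B` with `ρ = 0`, started from capital `c`: such a round is
lost at the multiples of `r` and won everywhere else. -/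
def stepB (r : ℕ) (c : ℤ) : ℤ :=
  if (r : ℤ) ∣ c then c - 1 else c + 1

variable {r : ℕ} {M : ℤ}

theorem not_dvd_add {j : ℤ} (hM : (r : ℤ) ∣ M) (hj : j ≠ 0) (hjr : |j| < r) :
    ¬ (r : ℤ) ∣ M + j := fun h =>
  hj (Int.eq_zero_of_abs_lt_dvd ((Int.dvd_add_right hM).1 h) hjr)

theorem stepB_of_dvd (hM : (r : ℤ) ∣ M) : stepB r M = M - 1 :=
  if_pos hM

theorem stepB_add (hM : (r : ℤ) ∣ M) {j : ℤ} (hj : j ≠ 0) (hjr : |j| < r) :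
    stepB r (M + j) = M + j + 1 :=
  if_neg (not_dvd_add hM hj hjr)

theorem iterate_stepB_add (hM : (r : ℤ) ∣ M) {j t : ℕ} (hj : 1 ≤ j) (ht : j + t ≤ r) :
    (stepB r)^[t] (M + j) = M + j + t := by
  induction t with
  | zero => simp
  | succ t ih =>
    rw [Function.iterate_succ_apply', ih (by omega), add_assoc,
      stepB_add hM (by omega) (abs_lt.2 ⟨by omega, by omega⟩)]
    push_cast
    ring

theorem iterate_stepB_of_dvd (hr : 2 ≤ r) (hM : (r : ℤ) ∣ M) (t : ℕ) :
    (stepB r)^[t] M = M - (t % 2 : ℕ) := by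
  induction t with
  | zero => simp
  | succ t ih =>
    rw [Function.iterate_succ_apply', ih]
    rcases Nat.mod_two_eq_zero_or_one t with ht | ht
    · rw [ht, Nat.cast_zero, sub_zero, stepB_of_dvd hM, Nat.succ_mod_two_eq_one_iff.2 ht,
        Nat.cast_one]
    · rw [ht, Nat.cast_one, sub_eq_add_neg, stepB_add hM (by simp) (by simp; omega),
        Nat.succ_mod_two_eq_zero_iff.2 ht]
      simp

theorem iterate_stepB_add_of_le (hr : 2 ≤ r) (hM : (r : ℤ) ∣ M) {j t : ℕ} (hj : 1 ≤ j)
    (hjr : j ≤ r) (ht : r ≤ j + t) :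
    (stepB r)^[t] (M + j) = M + r - ((j + t - r) % 2 : ℕ) := by
  have hclimb : (stepB r)^[r - j] (M + j) = M + r := by
    rw [iterate_stepB_add hM hj (by omega)]
    omega
  rw [show t = (j + t - r) + (r - j) by omega, Function.iterate_add_apply, hclimb,
    iterate_stepB_of_dvd hr (dvd_add hM dvd_rfl)]
  congr 4
  omega

theorem dvd_or_dvd_add_one_iterate_stepB (hr : 2 ≤ r) (c : ℤ) :
    (r : ℤ) ∣ (stepB r)^[r - 2] c ∨ (r : ℤ) ∣ (stepB r)^[r - 2] c + 1 := by
  obtain ⟨M, j, hM, hj, hjr, rfl⟩ :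
      ∃ (M : ℤ) (j : ℕ), (r : ℤ) ∣ M ∧ 1 ≤ j ∧ j ≤ r ∧ c = M + j := by
    have hnonneg : 0 ≤ (c - 1) % r := Int.emod_nonneg _ (by omega)
    have hlt : (c - 1) % r < r := Int.emod_lt_of_pos _ (by omega)
    exact ⟨c - 1 - (c - 1) % r, ((c - 1) % r).toNat + 1, Int.dvd_self_sub_emod, by omega,
      by omega, by omega⟩
  rcases hj.eq_or_lt with rfl | hj
  · right
    rw [iterate_stepB_add hM le_rfl (by omega),
      show M + (1 : ℕ) + (r - 2 : ℕ) + 1 = M + r by omega]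
    exact dvd_add hM dvd_rfl
  · rw [iterate_stepB_add_of_le hr hM hj.le hjr (by omega)]
    have hMr : (r : ℤ) ∣ M + r := dvd_add hM dvd_rfl
    rcases Nat.mod_two_eq_zero_or_one (j + (r - 2) - r) with h | h <;> simp [h, hMr]

end StepB

section Capital

variable {r : ℕ} {ρ : ℝ} {Γ : List Game} {x : ℤ} {ω : ℕ → unitInterval} {n : ℕ}

theorem capital_succ_eq_add_one_or_sub_one (r : ℕ) (ρ : ℝ) (Γ : List Game) (x : ℤ)
    (ω : ℕ → unitInterval) (n : ℕ) :
    capital r ρ Γ x ω (n + 1) = capital r ρ Γ x ω n + 1 ∨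
      capital r ρ Γ x ω (n + 1) = capital r ρ Γ x ω n - 1 := by
  rw [capital]
  exact ite_eq_or_eq _ _ _

theorem even_capital_sub_sub (n : ℕ) : Even (capital r ρ Γ x ω n - x - n) := by
  induction n with
  | zero => simp [capital]
  | succ n ih =>
    have hstep := capital_succ_eq_add_one_or_sub_one r ρ Γ x ω n
    grind

theorem capital_succ_of_A (hA : gameAt Γ n = Game.A) :
    capital r ρ Γ x ω (n + 1) =
      if (ω n : ℝ) < 1 / 2 then capital r ρ Γ x ω n + 1 else capital r ρ Γ x ω n - 1 := by
  simp only [capital, headsProb, hA]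

theorem capital_succ_of_B (hr : 2 ≤ r) (hω : (ω n : ℝ) < 1) (hB : gameAt Γ n = Game.B) :
    capital r 0 Γ x ω (n + 1) = stepB r (capital r 0 Γ x ω n) := by
  have hpow : (0 : ℝ) ^ (r - 1) = 0 := zero_pow (by omega)
  by_cases hd : (r : ℤ) ∣ capital r 0 Γ x ω n
  · simp only [capital, headsProb, stepB, hB, hd, if_true, hpow, zero_div,
      if_neg (unitInterval.nonneg (ω n)).not_gt]
  · simp only [capital, headsProb, stepB, hB, hd, if_false, add_zero, div_one, if_pos hω]

theorem capital_add_of_B (hr : 2 ≤ r) (hω : ∀ n, (ω n : ℝ) < 1) {t : ℕ}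
    (hB : ∀ i < t, gameAt Γ (n + i) = Game.B) :
    capital r 0 Γ x ω (n + t) = (stepB r)^[t] (capital r 0 Γ x ω n) := by
  induction t with
  | zero => rfl
  | succ t ih =>
    rw [← add_assoc, capital_succ_of_B hr (hω _) (hB t t.lt_succ_self), ih fun i hi =>
      hB i (hi.trans t.lt_succ_self), Function.iterate_succ_apply']

theorem capital_add_two_of_AB (hr : 2 ≤ r) (hω : (ω (n + 1) : ℝ) < 1)
    (hA : gameAt Γ n = Game.A) (hB : gameAt Γ (n + 1) = Game.B) :
    capital r 0 Γ x ω (n + 2) =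
      stepB r (capital r 0 Γ x ω n + if (ω n : ℝ) < 1 / 2 then 1 else -1) := by
  rw [capital_succ_of_B hr hω hB, capital_succ_of_A hA]
  split_ifs <;> rfl

/-- The number of heads among the `s` fair coins of a block `(AB)^s` whose first game is played at
turn `n + 1`. -/
noncomputable def fairHeads (s n : ℕ) (ω : ℕ → unitInterval) : ℕ :=
  ∑ j ∈ Finset.range s, if (ω (n + 2 * j) : ℝ) < 1 / 2 then 1 else 0

theorem fairHeads_le (s n : ℕ) (ω : ℕ → unitInterval) : fairHeads s n ω ≤ s := by
  rw [fairHeads, ← Finset.card_filter]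
  simpa using Finset.card_filter_le (Finset.range s) _

theorem fairHeads_succ (s n : ℕ) (ω : ℕ → unitInterval) :
    fairHeads (s + 1) n ω = fairHeads s n ω + if (ω (n + 2 * s) : ℝ) < 1 / 2 then 1 else 0 :=
  Finset.sum_range_succ _ _

variable {s : ℕ}

theorem capital_add_AB_of_dvd (hr : 2 ≤ r) (hs : 2 * s ≤ r) (hω : ∀ n, (ω n : ℝ) < 1)
    (hA : ∀ i < s, gameAt Γ (n + 2 * i) = Game.A)
    (hB : ∀ i < s, gameAt Γ (n + 2 * i + 1) = Game.B) (hd : (r : ℤ) ∣ capital r 0 Γ x ω n) :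
    capital r 0 Γ x ω (n + 2 * s) = capital r 0 Γ x ω n + 2 * fairHeads s n ω := by
  induction s with
  | zero => simp [fairHeads]
  | succ s ih =>
    have ih := ih (by omega) (fun i hi => hA i (by omega)) (fun i hi => hB i (by omega))
    have hle := fairHeads_le s n ω
    rw [mul_add, ← add_assoc, capital_add_two_of_AB hr (hω _) (hA s s.lt_succ_self)
      (hB s s.lt_succ_self), ih, fairHeads_succ, add_assoc, stepB_add hd]
    · split_ifs <;> push_cast <;> ring
    · split_ifs <;> omega
    · rw [abs_lt]
      split_ifs <;> omega

theorem capital_add_AB_of_dvd_add_one (hr : 3 ≤ r) (hω : ∀ n, (ω n : ℝ) < 1)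
    (hA : ∀ i < s, gameAt Γ (n + 2 * i) = Game.A)
    (hB : ∀ i < s, gameAt Γ (n + 2 * i + 1) = Game.B)
    (hd : (r : ℤ) ∣ capital r 0 Γ x ω n + 1) :
    capital r 0 Γ x ω (n + 2 * s) = capital r 0 Γ x ω n := by
  induction s with
  | zero => rfl
  | succ s ih =>
    rw [mul_add, ← add_assoc, capital_add_two_of_AB (by omega) (hω _) (hA s s.lt_succ_self)
      (hB s s.lt_succ_self), ih (fun i hi => hA i (by omega)) (fun i hi => hB i (by omega))]
    split_ifs
    · rw [stepB_of_dvd hd, add_sub_cancel_right]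
    · have h := stepB_add (j := -2) hd (by simp) (by simp; omega)
      ring_nf at h ⊢
      exact h

end Capital

section Pattern

variable {r s : ℕ}

theorem length_pattern (r s : ℕ) : (pattern r s).length = 2 * s + (r - 2) := by
  simp [pattern, mul_comm]

theorem gameAt_mul_length_add {Γ : List Game} {i : ℕ} {g : Game} (h : Γ[i]? = some g) (k : ℕ) :
    gameAt Γ (k * Γ.length + i) = g := by
  rw [gameAt, Nat.mul_add_mod_of_lt (List.getElem?_eq_some_iff.1 h).1, List.getD_eq_getElem?_getD,
    h, Option.getD_some]

theorem getElem?_pattern_two_mul {i : ℕ} (hi : i < s) :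
    (pattern r s)[2 * i]? = some Game.A := by
  induction s generalizing i with
  | zero => omega
  | succ s ih =>
    rcases i with _ | i
    · rfl
    · exact ih (Nat.lt_of_succ_lt_succ hi)

theorem getElem?_pattern_two_mul_add_one {i : ℕ} (hi : i < s) :
    (pattern r s)[2 * i + 1]? = some Game.B := by
  induction s generalizing i with
  | zero => omega
  | succ s ih =>
    rcases i with _ | i
    · rfl
    · exact ih (Nat.lt_of_succ_lt_succ hi)

theorem getElem?_pattern_two_mul_add {t : ℕ} (ht : t < r - 2) :
    (pattern r s)[2 * s + t]? = some Game.B := by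
  simp [pattern, mul_comm, ht]

end Pattern

section Period

/-- The capital at the beginning of the `k`-th period of the pattern `(AB)^s B^(r-2)`, periods being
numbered from `0`. -/
noncomputable def periodCapital (r s : ℕ) (x : ℤ) (ω : ℕ → unitInterval) (k : ℕ) : ℤ :=
  capital r 0 (pattern r s) x ω (k * (pattern r s).length)

/-- The event that all `s` fair coins of a block `(AB)^s` whose first game is played at turn `n + 1`
show tails. -/
def allTails (s n : ℕ) : Set (ℕ → unitInterval) :=
  {ω | ∀ j < s, 1 / 2 ≤ (ω (n + 2 * j) : ℝ)}

/-- The event that the capital at the beginning of the `k`-th period is a multiple of `r`. -/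
def onMultiple (r s : ℕ) (x : ℤ) (k : ℕ) : Set (ℕ → unitInterval) :=
  {ω | (r : ℤ) ∣ periodCapital r s x ω k}

variable {r s : ℕ} {x : ℤ} {ω : ℕ → unitInterval} {k : ℕ}

theorem mem_onMultiple : ω ∈ onMultiple r s x k ↔ (r : ℤ) ∣ periodCapital r s x ω k :=
  Iff.rfl

theorem fairHeads_eq_zero_iff {n : ℕ} : fairHeads s n ω = 0 ↔ ω ∈ allTails s n := by
  simp [fairHeads, allTails]

theorem periodCapital_succ (hr : 2 ≤ r) (hω : ∀ n, (ω n : ℝ) < 1) :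
    periodCapital r s x ω (k + 1) = (stepB r)^[r - 2]
      (capital r 0 (pattern r s) x ω (k * (pattern r s).length + 2 * s)) := by
  rw [← capital_add_of_B hr hω fun i hi => ?_, periodCapital, Nat.succ_mul, length_pattern,
    ← add_assoc]
  rw [add_assoc]
  exact gameAt_mul_length_add (getElem?_pattern_two_mul_add hi) k

theorem gameAt_pattern_two_mul (i : ℕ) (hi : i < s) :
    gameAt (pattern r s) (k * (pattern r s).length + 2 * i) = Game.A :=
  gameAt_mul_length_add (getElem?_pattern_two_mul hi) k

theorem gameAt_pattern_two_mul_add_one (i : ℕ) (hi : i < s) :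
    gameAt (pattern r s) (k * (pattern r s).length + 2 * i + 1) = Game.B := by
  rw [add_assoc]
  exact gameAt_mul_length_add (getElem?_pattern_two_mul_add_one hi) k

theorem periodCapital_succ_of_mem_allTails (hr : 2 ≤ r) (hs : 2 * s ≤ r)
    (hω : ∀ n, (ω n : ℝ) < 1) (hd : ω ∈ onMultiple r s x k)
    (ht : ω ∈ allTails s (k * (pattern r s).length)) :
    periodCapital r s x ω (k + 1) = periodCapital r s x ω k - (r % 2 : ℕ) := by
  rw [periodCapital_succ hr hω, capital_add_AB_of_dvd hr hs hω gameAt_pattern_two_mul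
    gameAt_pattern_two_mul_add_one hd, fairHeads_eq_zero_iff.2 ht, Nat.cast_zero, mul_zero,
    add_zero, ← periodCapital, iterate_stepB_of_dvd hr hd, ← Nat.mod_eq_sub_mod hr]

theorem periodCapital_succ_of_notMem_allTails (hr : 2 ≤ r) (hs : 2 * s ≤ r)
    (hω : ∀ n, (ω n : ℝ) < 1) (hd : ω ∈ onMultiple r s x k)
    (ht : ω ∉ allTails s (k * (pattern r s).length)) :
    periodCapital r s x ω (k + 1) = periodCapital r s x ω k + r := by
  have hpos : fairHeads s (k * (pattern r s).length) ω ≠ 0 := mt fairHeads_eq_zero_iff.1 ht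
  have hle := fairHeads_le s (k * (pattern r s).length) ω
  rw [periodCapital_succ hr hω, capital_add_AB_of_dvd hr hs hω gameAt_pattern_two_mul
    gameAt_pattern_two_mul_add_one hd]
  have hclimb := iterate_stepB_add_of_le hr hd (t := r - 2)
    (j := 2 * fairHeads s (k * (pattern r s).length) ω) (by omega) (by omega) (by omega)
  push_cast at hclimb
  rw [periodCapital] at hclimb ⊢
  omega

theorem periodCapital_succ_of_dvd_add_one (hr : 3 ≤ r) (hodd : Odd r) (hω : ∀ n, (ω n : ℝ) < 1)
    (hd : (r : ℤ) ∣ periodCapital r s x ω k + 1) :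
    periodCapital r s x ω (k + 1) = periodCapital r s x ω k + 1 := by
  have hclimb := iterate_stepB_add_of_le (by omega) (dvd_sub hd dvd_rfl) (t := r - 2) (j := r - 1)
    (by omega) (by omega) (by omega)
  rw [periodCapital_succ (by omega) hω, capital_add_AB_of_dvd_add_one hr hω gameAt_pattern_two_mul
    gameAt_pattern_two_mul_add_one hd]
  rw [show periodCapital r s x ω k + 1 - r + (r - 1 : ℕ) = periodCapital r s x ω k by omega]
    at hclimb
  rw [periodCapital] at hclimb ⊢
  grind

theorem dvd_or_dvd_add_one_periodCapital_succ (hr : 2 ≤ r) (hω : ∀ n, (ω n : ℝ) < 1) (k : ℕ) :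
    (r : ℤ) ∣ periodCapital r s x ω (k + 1) ∨ (r : ℤ) ∣ periodCapital r s x ω (k + 1) + 1 := by
  rw [periodCapital_succ hr hω]
  exact dvd_or_dvd_add_one_iterate_stepB hr _

theorem not_dvd_periodCapital_add_one (hr : Even r) (hx : Even x) :
    ¬ (r : ℤ) ∣ periodCapital r s x ω k + 1 := by
  intro hd
  have hparity : Even (periodCapital r s x ω k - x - (k * (pattern r s).length : ℕ)) :=
    even_capital_sub_sub _
  have hlength : Even (k * (pattern r s).length) := by
    rw [length_pattern]
    grind
  have h := even_iff_two_dvd.2 (((Int.natCast_dvd_natCast.2 hr.two_dvd)).trans hd)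
  grind

theorem mem_onMultiple_succ_or (hr : 2 ≤ r) (hx : Even r → Even x) (hω : ∀ n, (ω n : ℝ) < 1)
    (k : ℕ) : ω ∈ onMultiple r s x (k + 1) ∨
      Odd r ∧ (r : ℤ) ∣ periodCapital r s x ω (k + 1) + 1 := by
  refine (dvd_or_dvd_add_one_periodCapital_succ hr hω k).imp_right fun hd => ⟨?_, hd⟩
  by_contra h
  rw [Nat.not_odd_iff_even] at h
  exact not_dvd_periodCapital_add_one h (hx h) hd

theorem mem_onMultiple_succ_iff (hr : 3 ≤ r) (hs : 2 * s ≤ r) (hω : ∀ n, (ω n : ℝ) < 1)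
    (h : ω ∈ onMultiple r s x k ∨ Odd r ∧ (r : ℤ) ∣ periodCapital r s x ω k + 1) :
    ω ∈ onMultiple r s x (k + 1) ↔
      ¬ (Odd r ∧ ω ∈ onMultiple r s x k ∧ ω ∈ allTails s (k * (pattern r s).length)) := by
  by_cases hd : ω ∈ onMultiple r s x k
  · by_cases ht : ω ∈ allTails s (k * (pattern r s).length)
    · simp only [hd, ht, and_true, Nat.not_odd_iff_even]
      rw [mem_onMultiple, periodCapital_succ_of_mem_allTails (by omega) hs hω hd ht]
      rcases Nat.mod_two_eq_zero_or_one r with hr2 | hr2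
      · simpa [hr2, Nat.even_iff] using mem_onMultiple.1 hd
      · simpa [hr2, Nat.even_iff, sub_eq_add_neg] using
          not_dvd_add (j := -1) hd (by simp) (by simp; omega)
    · simp only [ht, and_false, not_false_iff, iff_true]
      rw [mem_onMultiple, periodCapital_succ_of_notMem_allTails (by omega) hs hω hd ht]
      exact dvd_add hd dvd_rfl
  · obtain ⟨hodd, hd1⟩ := h.resolve_left hd
    simp only [hd, false_and, and_false, not_false_iff, iff_true]
    rwa [mem_onMultiple, periodCapital_succ_of_dvd_add_one hr hodd hω hd1]

open Set in
theorem indicator_onMultiple_succ (hr : 3 ≤ r) (hs : 2 * s ≤ r) (hω : ∀ n, (ω n : ℝ) < 1)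
    (h : ω ∈ onMultiple r s x k ∨ Odd r ∧ (r : ℤ) ∣ periodCapital r s x ω k + 1) :
    indicator (onMultiple r s x (k + 1)) (1 : (ℕ → unitInterval) → ℝ) ω = 1 - (r % 2 : ℕ) *
      (indicator (onMultiple r s x k) 1 ω *
        indicator (allTails s (k * (pattern r s).length)) 1 ω) := by
  have hiff := mem_onMultiple_succ_iff hr hs hω h
  rcases Nat.mod_two_eq_zero_or_one r with hr2 | hr2 <;>
    by_cases hd : ω ∈ onMultiple r s x k <;>
    by_cases ht : ω ∈ allTails s (k * (pattern r s).length) <;>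
    simp_all [Nat.odd_iff]

open Set in
theorem periodCapital_succ_sub (hr : 3 ≤ r) (hs : 2 * s ≤ r) (hω : ∀ n, (ω n : ℝ) < 1)
    (h : ω ∈ onMultiple r s x k ∨ Odd r ∧ (r : ℤ) ∣ periodCapital r s x ω k + 1) :
    (periodCapital r s x ω (k + 1) - periodCapital r s x ω k : ℝ) =
      r * (indicator (onMultiple r s x k) 1 ω *
        (1 - indicator (allTails s (k * (pattern r s).length)) 1 ω)) +
      (indicator (onMultiple r s x (k + 1)) 1 ω - indicator (onMultiple r s x k) 1 ω) := by
  rw [indicator_onMultiple_succ hr hs hω h]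
  by_cases hd : ω ∈ onMultiple r s x k
  · by_cases ht : ω ∈ allTails s (k * (pattern r s).length)
    · rw [periodCapital_succ_of_mem_allTails (by omega) hs hω hd ht, Int.cast_sub, Int.cast_natCast]
      simp [hd, ht]
    · simp [hd, ht, periodCapital_succ_of_notMem_allTails (by omega) hs hω hd ht]
  · obtain ⟨hodd, hd1⟩ := h.resolve_left hd
    simp [hd, periodCapital_succ_of_dvd_add_one hr hodd hω hd1]

end Period

section Probability

open ProbabilityTheory

instance : IsProbabilityMeasure uniformSeq := by
  unfold uniformSeq
  infer_instance

theorem ae_lt_one : ∀ᵐ ω ∂uniformSeq, ∀ n, (ω n : ℝ) < 1 := by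
  refine ae_all_iff.2 fun n => ?_
  have heval : MeasurePreserving (fun ω : ℕ → unitInterval => ω n) uniformSeq volume :=
    measurePreserving_eval_infinitePi (fun _ : ℕ => (volume : Measure unitInterval)) n
  filter_upwards [heval.quasiMeasurePreserving.ae (Measure.ae_ne volume 1)] with ω hω
  exact unitInterval.lt_one_iff_ne_one.2 hω

theorem measurable_capital (r : ℕ) (ρ : ℝ) (Γ : List Game) (x : ℤ) (n : ℕ) :
    Measurable[cylinderEvents (Set.Iio n)] fun ω => capital r ρ Γ x ω n := by
  induction n with
  | zero => exact measurable_const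
  | succ n ih =>
    have hpast : Measurable[cylinderEvents (Set.Iio (n + 1))] fun ω => capital r ρ Γ x ω n :=
      ih.mono (cylinderEvents_mono (Set.Iio_subset_Iio n.le_succ)) le_rfl
    have hcoin : Measurable[cylinderEvents (Set.Iio (n + 1))]
        fun ω : ℕ → unitInterval => (ω n : ℝ) :=
      measurable_subtype_coe.comp (measurable_cylinderEvent_apply n.lt_succ_self)
    have hheads : Measurable[cylinderEvents (Set.Iio (n + 1))]
        fun ω => headsProb r ρ (gameAt Γ n) (capital r ρ Γ x ω n) :=
      (Measurable.of_discrete (f := headsProb r ρ (gameAt Γ n))).comp hpast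
    exact Measurable.ite (measurableSet_lt hcoin hheads) (hpast.add_const 1) (hpast.sub_const 1)

theorem measurableSet_allTails (s n : ℕ) :
    MeasurableSet[cylinderEvents (Set.Ico n (n + 2 * s))] (allTails s n) := by
  have hset : allTails s n = ⋂ j < s, (fun ω : ℕ → unitInterval => (ω (n + 2 * j) : ℝ)) ⁻¹'
      Set.Ici (1 / 2) := by
    ext ω
    simp [allTails]
  rw [hset]
  refine MeasurableSet.iInter fun j => MeasurableSet.iInter fun hj => ?_
  have hcoin : Measurable[cylinderEvents (Set.Ico n (n + 2 * s))]
      fun ω : ℕ → unitInterval => (ω (n + 2 * j) : ℝ) :=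
    measurable_subtype_coe.comp (measurable_cylinderEvent_apply ⟨by omega, by omega⟩)
  exact hcoin measurableSet_Ici

theorem uniformSeq_real_allTails (s n : ℕ) : uniformSeq.real (allTails s n) = (1 / 2) ^ s := by
  have hset : allTails s n = Set.pi ((Finset.range s).image fun j => n + 2 * j)
      fun _ => Set.Ici ⟨1 / 2, unitInterval.div_mem zero_le_one zero_le_two one_le_two⟩ := by
    ext ω
    simp [allTails, Set.mem_pi, ← Subtype.coe_le_coe]
  have hinj : Function.Injective fun j => n + 2 * j := fun a b h => by simpa using h
  rw [hset, measureReal_def, uniformSeq, Measure.infinitePi_pi _ fun _ _ => measurableSet_Ici,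
    Finset.prod_const, unitInterval.volume_Ici, Finset.card_image_of_injective _ hinj,
    Finset.card_range, ENNReal.toReal_pow, ENNReal.toReal_ofReal (by norm_num)]
  norm_num

/-- The indicator of `allTails s n`, centred by its expectation. -/
noncomputable def centredTails (s n : ℕ) (ω : ℕ → unitInterval) : ℝ :=
  (allTails s n).indicator 1 ω - (1 / 2) ^ s

theorem measurable_centredTails (s n : ℕ) :
    Measurable[cylinderEvents (Set.Ico n (n + 2 * s))] (centredTails s n) :=
  (measurable_const.indicator (measurableSet_allTails s n)).sub_const _

theorem abs_centredTails_le_one (s n : ℕ) (ω : ℕ → unitInterval) : |centredTails s n ω| ≤ 1 :=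
  abs_sub_le_of_nonneg_of_le (Set.indicator_nonneg (fun _ _ => zero_le_one) ω)
    (Set.indicator_le' (fun _ _ => le_rfl) (fun _ _ => zero_le_one) ω) (by positivity)
    (pow_le_one₀ (by norm_num) (by norm_num))

theorem integral_centredTails (s n : ℕ) : ∫ ω, centredTails s n ω ∂uniformSeq = 0 := by
  have hmeas := cylinderEvents_le_pi _ (measurableSet_allTails s n)
  simp only [centredTails]
  rw [integral_sub ((integrable_indicator_iff hmeas).2 (integrable_const _).integrableOn)
    (integrable_const _), integral_indicator_one hmeas, uniformSeq_real_allTails]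
  simp

/-- The filtration whose `k`-th term is generated by the turns that precede the period `k + 1` when
the periods have `L` turns. -/
def periodFiltration (L : ℕ) :
    Filtration ℕ (MeasurableSpace.pi : MeasurableSpace (ℕ → unitInterval)) where
  seq k := cylinderEvents (Set.Iio ((k + 1) * L))
  mono' _ _ hij := cylinderEvents_mono (Set.Iio_subset_Iio (by gcongr))
  le' _ := cylinderEvents_le_pi

variable (r s : ℕ) (x : ℤ)

theorem measurableSet_onMultiple (k : ℕ) :
    MeasurableSet[periodFiltration (pattern r s).length k] (onMultiple r s x (k + 1)) :=
  measurable_capital r 0 (pattern r s) x _ (MeasurableSet.of_discrete (s := {c : ℤ | (r : ℤ) ∣ c}))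

theorem ae_tendsto_sum_onMultiple_mul_centredTails :
    ∀ᵐ ω ∂uniformSeq, Tendsto (fun n : ℕ => (∑ k ∈ Finset.range n,
      (onMultiple r s x (k + 1)).indicator 1 ω *
        centredTails s ((k + 1) * (pattern r s).length) ω) / n) atTop (𝓝 0) := by
  set L := (pattern r s).length
  have hL : 2 * s ≤ L := by simp [L, length_pattern]
  refine ae_tendsto_sum_mul_div_of_indep (ℱ := periodFiltration L) (C := 1) (D := 1)
    (fun k => measurable_const.indicator (measurableSet_onMultiple r s x k)) (fun k => ?_)
    (fun k => ?_) (fun k ω => ?_) (fun k => abs_centredTails_le_one s _)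
    (fun k => integral_centredTails s _)
  · refine (measurable_centredTails s _).mono (cylinderEvents_mono fun i hi => ?_) le_rfl
    rw [Set.mem_Iio, Nat.succ_mul (k + 1)]
    exact hi.2.trans_le (Nat.add_le_add_left hL _)
  · refine indep_of_indep_of_le_right (indep_cylinderEvents_infinitePi _ ?_)
      (measurable_centredTails s _).comap_le
    exact Set.disjoint_left.2 fun i hi hi' => (hi'.1.trans_lt hi).false
  · by_cases h : ω ∈ onMultiple r s x (k + 1) <;> simp [h]

end Probability

section Rate

/-- The rate of profit of the pattern `(AB)^s B^(r-2)` with `ρ = 0`: in the stationary regime, the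
mean profit of a period divided by the number of its turns. -/
noncomputable def patternRate (r s : ℕ) : ℝ :=
  r * (1 - (1 / 2) ^ s) / (1 + (r % 2 : ℕ) * (1 / 2) ^ s) / (2 * s + (r - 2) : ℕ)

variable {r s : ℕ} {x : ℤ}

theorem ae_tendsto_periodCapital_div (hr : 3 ≤ r) (hs : 2 * s ≤ r) (hx : Even r → Even x) :
    ∀ᵐ ω ∂uniformSeq, Tendsto (fun k : ℕ => (periodCapital r s x ω k : ℝ) / k) atTop
      (𝓝 (r * (1 - (1 / 2) ^ s) / (1 + (r % 2 : ℕ) * (1 / 2) ^ s))) := by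
  filter_upwards [ae_lt_one, ae_tendsto_sum_onMultiple_mul_centredTails r s x] with ω hω hlln
  have hinv := mem_onMultiple_succ_or (s := s) (by omega) hx hω
  refine tendsto_div_of_tendsto_succ_div (tendsto_div_of_renewal (K := 1)
    (v := fun k => (onMultiple r s x (k + 1)).indicator 1 ω)
    (τ := fun k => (allTails s ((k + 1) * (pattern r s).length)).indicator 1 ω)
    (by positivity) (fun k => ?_) (fun k => indicator_onMultiple_succ hr hs hω (hinv k))
    (fun k => periodCapital_succ_sub hr hs hω (hinv k)) hlln)
  by_cases h : ω ∈ onMultiple r s x (k + 1) <;> simp [h]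

theorem hasRateOfProfit_of_tendsto_periods {ρ m : ℝ} {Γ : List Game} (hΓ : Γ ≠ [])
    (h : ∀ᵐ ω ∂uniformSeq, Tendsto (fun k : ℕ => (capital r ρ Γ x ω (k * Γ.length) : ℝ) / k) atTop
      (𝓝 m)) : HasRateOfProfit r ρ Γ x (m / Γ.length) := by
  have hL : (Γ.length : ℝ) ≠ 0 := Nat.cast_ne_zero.2 (mt List.length_eq_zero_iff.1 hΓ)
  filter_upwards [h] with ω hω
  have hcapital : Tendsto (fun n : ℕ => (capital r ρ Γ x ω n : ℝ) / n) atTop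
      (𝓝 (m / Γ.length)) := by
    refine tendsto_div_of_tendsto_subseq_div (K := 1) (c := fun k => k * Γ.length) (fun n => ?_)
      (tendsto_id.atTop_mul_const' (List.length_pos_iff.2 hΓ)) ?_ ?_
    · have hstep := capital_succ_eq_add_one_or_sub_one r ρ Γ x ω n
      exact_mod_cast show capital r ρ Γ x ω n - 1 ≤ capital r ρ Γ x ω (n + 1) by omega
    · simpa only [Nat.cast_mul, mul_div_mul_right _ _ hL] using tendsto_succ_div_self_atTop
    · simpa only [Nat.cast_mul, div_mul_eq_div_div] using hω.div_const (Γ.length : ℝ)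
  simpa only [sub_div, sub_zero] using hcapital.sub (tendsto_const_div_atTop_nhds_zero_nat (x : ℝ))

theorem hasRateOfProfit_pattern (hr : 3 ≤ r) (hs : 2 * s ≤ r) (hx : Even r → Even x) :
    HasRateOfProfit r 0 (pattern r s) x (patternRate r s) := by
  have hpattern : pattern r s ≠ [] := List.ne_nil_of_length_pos (by rw [length_pattern]; omega)
  rw [patternRate, ← length_pattern]
  exact hasRateOfProfit_of_tendsto_periods hpattern (ae_tendsto_periodCapital_div hr hs hx)

end Rate

section Asymptotics

theorem one_sub_patternRate {r : ℕ} (hr : 3 ≤ r) (s : ℕ) :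
    1 - patternRate r s =
      (2 * s + ((1 + (r % 2 : ℕ)) * (r * (1 / 2) ^ s) + (r % 2 : ℕ) * (1 / 2) ^ s * (2 * s) -
        2 * (1 + (r % 2 : ℕ) * (1 / 2) ^ s))) /
      ((1 + (r % 2 : ℕ) * (1 / 2) ^ s) * (r + (2 * s - 2))) := by
  have hlength : ((2 * s + (r - 2) : ℕ) : ℝ) = r + (2 * s - 2) := by
    rw [Nat.cast_add, Nat.cast_sub (by omega)]
    push_cast
    ring
  have hpos : (0 : ℝ) < r + (2 * s - 2) := hlength ▸ Nat.cast_pos.2 (by omega)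
  rw [patternRate, hlength, div_div, eq_div_iff (by positivity), sub_mul,
    div_mul_cancel₀ _ (by positivity)]
  ring

theorem const_isLittleO_natCast {ι : Type*} {l : Filter ι} {u : ι → ℕ} (hu : Tendsto u l atTop)
    (c : ℝ) : (fun _ => c) =o[l] fun i => (u i : ℝ) :=
  isLittleO_const_left.2 <| .inr <|
    tendsto_norm_atTop_atTop.comp (tendsto_natCast_atTop_atTop.comp hu)

theorem one_sub_patternRate_isEquivalent {s : ℕ → ℕ} (hs : Tendsto s atTop atTop)
    (hsr : (fun r => (s r : ℝ)) =o[atTop] fun r => (r : ℝ))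
    (hrq : (fun r : ℕ => (r : ℝ) * (1 / 2) ^ s r) =o[atTop] fun r => (s r : ℝ)) :
    (fun r => 1 - patternRate r (s r)) ~[atTop] fun r => 2 * (s r : ℝ) / r := by
  let q (r : ℕ) : ℝ := (1 / 2) ^ s r
  let δ (r : ℕ) : ℝ := (r % 2 : ℕ)
  have hq : Tendsto q atTop (𝓝 0) :=
    (tendsto_pow_atTop_nhds_zero_of_lt_one (by norm_num) (by norm_num)).comp hs
  have hδ : δ =O[atTop] fun _ => (1 : ℝ) := .of_bound 1 <| .of_forall fun r => by
    rcases Nat.mod_two_eq_zero_or_one r with h | h <;> simp [δ, h]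
  have hδq : (fun r => δ r * q r) =o[atTop] fun _ => (1 : ℝ) := by
    simpa only [one_mul] using hδ.mul_isLittleO ((isLittleO_one_iff ℝ).2 hq)
  have hone : (fun r => 1 + δ r * q r) ~[atTop] fun _ => (1 : ℝ) :=
    IsEquivalent.refl.add_isLittleO hδq
  have hnum : (fun r => (1 + δ r) * (r * q r) + δ r * q r * (2 * s r) - 2 * (1 + δ r * q r))
      =o[atTop] fun r => 2 * (s r : ℝ) := by
    have hfirst : (fun r => (1 + δ r) * (r * q r)) =o[atTop] fun r => (s r : ℝ) := by
      simpa only [one_mul] using ((isBigO_refl _ _).add hδ).mul_isLittleO hrq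
    have hsecond : (fun r => δ r * q r * (2 * s r)) =o[atTop] fun r => 2 * (s r : ℝ) := by
      simpa only [one_mul] using hδq.mul_isBigO (isBigO_refl (fun r => 2 * (s r : ℝ)) atTop)
    have hthird : (fun r => 2 * (1 + δ r * q r)) =o[atTop] fun r => (s r : ℝ) :=
      (hone.isBigO.const_mul_left 2).trans_isLittleO (const_isLittleO_natCast hs 1)
    exact ((hfirst.const_mul_right two_ne_zero).add hsecond).sub
      (hthird.const_mul_right two_ne_zero)
  have hlength : (fun r : ℕ => (r : ℝ) + (2 * s r - 2)) ~[atTop] fun r => (r : ℝ) :=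
    IsEquivalent.refl.add_isLittleO
      ((hsr.const_mul_left 2).sub (const_isLittleO_natCast tendsto_id 2))
  have hden : (fun r : ℕ => (1 + δ r * q r) * (r + (2 * s r - 2))) ~[atTop] fun r => (r : ℝ) := by
    simpa only [Pi.mul_def, one_mul] using hone.mul hlength
  refine ((IsEquivalent.refl.add_isLittleO hnum).div hden).congr_left ?_
  filter_upwards [eventually_ge_atTop 3] with r hr
  exact (one_sub_patternRate hr (s r)).symm

theorem sFun_eq_log_sub_one (r : ℕ) : sFun r = Nat.log 2 r - 1 := by
  rw [sFun]
  exact congrArg (· - 1) (Real.natFloor_logb_natCast 2 r)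

theorem two_pow_sFun_succ_le {r : ℕ} (hr : 2 ≤ r) : 2 ^ (sFun r + 1) ≤ r := by
  rw [sFun_eq_log_sub_one, Nat.sub_add_cancel (Nat.log_pos one_lt_two hr)]
  exact Nat.pow_log_le_self 2 (by omega)

theorem lt_two_pow_sFun_add_two (r : ℕ) : r < 2 ^ (sFun r + 2) := by
  refine (Nat.lt_pow_succ_log_self one_lt_two r).trans_le (Nat.pow_le_pow_right two_pos ?_)
  rw [sFun_eq_log_sub_one]
  omega

theorem two_mul_sFun_le {r : ℕ} (hr : 2 ≤ r) : 2 * sFun r ≤ r :=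
  calc 2 * sFun r ≤ 2 * 2 ^ sFun r := Nat.mul_le_mul_left 2 Nat.lt_two_pow_self.le
    _ = 2 ^ (sFun r + 1) := (pow_succ' 2 _).symm
    _ ≤ r := two_pow_sFun_succ_le hr

theorem tendsto_sFun_atTop : Tendsto sFun atTop atTop := by
  refine tendsto_atTop_atTop.2 fun b => ⟨2 ^ (b + 1), fun r hr => ?_⟩
  have hlt := (Nat.pow_lt_pow_iff_right one_lt_two).1 (hr.trans_lt (lt_two_pow_sFun_add_two r))
  omega

theorem sFun_isLittleO : (fun r => (sFun r : ℝ)) =o[atTop] fun r => (r : ℝ) := by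
  have hpow : (fun r => (sFun r : ℝ)) =o[atTop] fun r => (2 : ℝ) ^ sFun r :=
    (isLittleO_coe_const_pow_of_one_lt (R := ℝ) one_lt_two).comp_tendsto tendsto_sFun_atTop
  refine hpow.trans_isBigO (.of_bound 1 ?_)
  filter_upwards [eventually_ge_atTop 2] with r hr
  have hle : (2 : ℝ) ^ sFun r ≤ r := by
    exact_mod_cast (Nat.pow_le_pow_right two_pos (Nat.le_succ _)).trans (two_pow_sFun_succ_le hr)
  simpa using hle

theorem mul_half_pow_sFun_isLittleO :
    (fun r : ℕ => (r : ℝ) * (1 / 2) ^ sFun r) =o[atTop] fun r => (sFun r : ℝ) := by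
  have hbounded : (fun r : ℕ => (r : ℝ) * (1 / 2) ^ sFun r) =O[atTop] fun _ => (1 : ℝ) := by
    refine .of_bound 4 (.of_forall fun r => ?_)
    have hle : (r : ℝ) ≤ 2 ^ (sFun r + 2) := by exact_mod_cast (lt_two_pow_sFun_add_two r).le
    rw [Real.norm_of_nonneg (by positivity)]
    calc (r : ℝ) * (1 / 2) ^ sFun r ≤ 2 ^ (sFun r + 2) * (1 / 2) ^ sFun r := by gcongr
      _ = 4 * (2 * (1 / 2)) ^ sFun r := by rw [mul_pow]; ring
      _ = 4 * ‖(1 : ℝ)‖ := by norm_num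
  exact hbounded.trans_isLittleO (const_isLittleO_natCast tendsto_sFun_atTop 1)

end Asymptotics

end Parrondo

theorem corollary6 (x₀ : ℕ → ℤ) (hx₀ : ∀ r : ℕ, 3 ≤ r → Even r → Even (x₀ r)) :
    ∃ μ : ℕ → ℝ,
      (∀ r : ℕ, 3 ≤ r →
        Parrondo.HasRateOfProfit r 0 (Parrondo.pattern r (Parrondo.sFun r)) (x₀ r) (μ r)) ∧
      (fun r : ℕ => 1 - μ r) ~[atTop] (fun r : ℕ => 2 * (Parrondo.sFun r : ℝ) / (r : ℝ)) :=
  ⟨fun r => Parrondo.patternRate r (Parrondo.sFun r),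
    fun r hr => Parrondo.hasRateOfProfit_pattern hr (Parrondo.two_mul_sFun_le (by omega))
      (hx₀ r hr),
    Parrondo.one_sub_patternRate_isEquivalent Parrondo.tendsto_sFun_atTop
      Parrondo.sFun_isLittleO Parrondo.mul_half_pow_sFun_isLittleO⟩
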